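/- For $k\in\mathbb N=\{0,1,2,\dots\}$ let $J_k$ be the Bessel function of the first kind of order $k$, and let $j_{k,n}$ ($n\ge 1$) be its $n$-th positive root. For $\kappa>0$ and $\alpha>0$ put $$F_k(\alpha)=\frac{\kappa}{\alpha}\,J_k(\alpha)\,J_k'\Bigl(\frac{\kappa}{\alpha}\Bigr)-\alpha\,J_k\Bigl(\frac{\kappa}{\alpha}\Bigr)J_k'(\alpha),$$ and let $\alpha_{k,1}(\kappa)$ be the smallest root of $F_k$ in $(\sqrt{\kappa},+\infty)$. Proposition. Let $k\in\mathbb N$ and $\kappa>0$. The roots $\alpha_{k,1}(\kappa)$ and $j_{k+1,n}$, $n\ge1$, exist, and $$\alpha_{k,1}(\kappa)\le\alpha_{k+2,1}(\kappa).$$ Equality holds if and only if $\kappa=j_{k+1,n}\,j_{k+1,n+1}$ for some $n\ge 1$, and in that case $$\alpha_{k,1}(\kappa)=\alpha_{k+1,1}(\kappa)=\alpha_{k+2,1}(\kappa)=j_{k+1,n+1}.$$ -/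

import Mathlib

namespace Buckling

noncomputable section

/-- The Bessel function of the first kind of integer order `ν ≥ 0`,
`J_ν(x) = ∑_{m ≥ 0} (-1)^m / (m! (m + ν)!) (x / 2)^(2 m + ν)`. -/
def besselJ (ν : ℕ) (x : ℝ) : ℝ :=
  ∑' m : ℕ, (-1 : ℝ) ^ m / ((m.factorial : ℝ) * ((m + ν).factorial : ℝ)) *
    (x / 2) ^ (2 * m + ν)

/-- The series defining `besselJ` converges everywhere. -/
theorem summable_besselJ (ν : ℕ) (x : ℝ) :
    Summable (fun m : ℕ => (-1 : ℝ) ^ m / ((m.factorial : ℝ) * ((m + ν).factorial : ℝ)) *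
      (x / 2) ^ (2 * m + ν)) := by
  have h := (Real.summable_pow_div_factorial ((x / 2) ^ 2)).mul_right (|x / 2| ^ ν)
  refine Summable.of_norm_bounded h (fun m => ?_)
  have h1 : (0 : ℝ) < m.factorial := by exact_mod_cast m.factorial_pos
  have h2 : (1 : ℝ) ≤ (m + ν).factorial := by exact_mod_cast (m + ν).factorial_pos
  have e : ‖(-1 : ℝ) ^ m / ((m.factorial : ℝ) * ((m + ν).factorial : ℝ)) *
      (x / 2) ^ (2 * m + ν)‖ =
      ((x / 2) ^ 2) ^ m / ((m.factorial : ℝ) * ((m + ν).factorial : ℝ)) * |x / 2| ^ ν := by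
    rw [norm_mul, norm_div, norm_pow, norm_mul, norm_pow, Real.norm_eq_abs (x / 2), pow_add,
      pow_mul, sq_abs]
    simp
    ring
  rw [e]
  gcongr
  exact le_mul_of_one_le_right h1.le h2

/-- `rootAfter f a n` is the `n`-th root of `f` in `(a, ∞)`, the roots being listed in increasing
order without repetition; by convention `rootAfter f a 0 = a`. -/
def rootAfter (f : ℝ → ℝ) (a : ℝ) : ℕ → ℝ
  | 0 => a
  | n + 1 => sInf {x : ℝ | rootAfter f a n < x ∧ f x = 0}

/-- `j_{ν,n}`, the `n`-th positive root of `J_ν` (`n ≥ 1`), with `j_{ν,0} = 0`. -/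
def besselZero (ν n : ℕ) : ℝ := rootAfter (besselJ ν) 0 n

/-- The function
`F_k(α) = (κ / α) J_k(α) J_k'(κ / α) - α J_k(κ / α) J_k'(α)`. -/
def F (k : ℕ) (κ α : ℝ) : ℝ :=
  κ / α * besselJ k α * deriv (besselJ k) (κ / α) -
    α * besselJ k (κ / α) * deriv (besselJ k) α

/-- `α_{k,ℓ}(κ)` for `ℓ ≥ 0`: `α_{k,0}(κ) = √κ`, and for `ℓ ≥ 1` it is the `ℓ`-th root of `F_k`
in `(√κ, ∞)`. -/
def alpha (k ℓ : ℕ) (κ : ℝ) : ℝ := rootAfter (F k κ) (Real.sqrt κ) ℓ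

end

end Buckling

/-!
Write `β = κ / α`, `ν = k + 1`. The functions `F_k`, `F_{k+1}`, `F_{k+2}` are, up to the constant
factor `κ` in the first and third case, cross products `X(α) Y(β) - X(β) Y(α)` of the values at
`α` and `β` of planar curves with the same first component `X = J_ν`; the second components are
`J_k(x) / x`, `x J_k(x)` and `-J_{k+2}(x) / x` (`F_eq`, `F_succ_eq`). The Wronskians of these
curves are positive multiples of Lommel's form `x² J_n'² + (x² - n²) J_n²` with `n = k, k + 1,
k + 2`, which is positive because its derivative is `2 x J_n²` (`lommel_pos`). Hence each curve has
a continuous strictly increasing polar angle `θ` (`exists_isPhase`), the cross product is a positive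
multiple of `sin (θ(α) - θ(β))`, and its first root beyond `√κ` is the point at which
`θ(α) - θ(β)` reaches `π` (`IsPhase.isLeast_root`). Zeros of `J_ν` are the points where `θ` is a
multiple of `π`, for each of the three angles, so two zeros are consecutive exactly when they are
half a turn apart; that there are infinitely many follows from the angle of `(J_k, J_ν)`, whose
derivative tends to `1`.

If `κ` is the product of two consecutive zeros of `J_ν`, all three first roots are therefore the
larger zero. In general let `α` be the first root for `k`. The recurrence for Bessel functions
shows that the third curve is the first one sheared by `Y ↦ Y - (2ν / x²) X`. The shear coefficient
decreases in `x`, so while the first curve turns by exactly `π` from `β` to `α`, the third one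
turns by less than `π`, unless `J_ν(α) = 0` (`IsPhase.shear_sub_lt_pi`). Thus the first root for
`k + 2` is larger, except when `J_ν(α) = 0`, and then `β` and `α` are consecutive zeros of `J_ν`.
-/

namespace Buckling

/-! ### Bessel functions: derivative and recurrence -/

/-- The entire function `E_n(z) = ∑ (-1)^m z^m / (m! (m + n)!)`, the power series part of the
Bessel function: `J_n(x) = (x / 2)^n E_n(x² / 4)`. -/
noncomputable def besselE (n : ℕ) (z : ℝ) : ℝ :=
  ∑' m : ℕ, (-1 : ℝ) ^ m / ((m.factorial : ℝ) * ((m + n).factorial : ℝ)) * z ^ m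

theorem abs_besselE_coeff_le (n m : ℕ) :
    |(-1 : ℝ) ^ m / ((m.factorial : ℝ) * ((m + n).factorial : ℝ))| ≤ 1 / (m.factorial : ℝ) := by
  have h1 : (0 : ℝ) < m.factorial := by exact_mod_cast m.factorial_pos
  have h2 : (1 : ℝ) ≤ (m + n).factorial := by exact_mod_cast (m + n).factorial_pos
  rw [abs_div, abs_pow, abs_neg, abs_one, one_pow, abs_of_pos (by positivity)]
  gcongr
  exact le_mul_of_one_le_right h1.le h2

theorem hasSum_besselE (n : ℕ) (z : ℝ) :
    HasSum (fun m : ℕ => (-1 : ℝ) ^ m / ((m.factorial : ℝ) * ((m + n).factorial : ℝ)) * z ^ m)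
      (besselE n z) := by
  refine Summable.hasSum (Summable.of_norm_bounded (Real.summable_pow_div_factorial |z|)
    fun m => ?_)
  rw [norm_mul, norm_pow, Real.norm_eq_abs, Real.norm_eq_abs]
  calc _ ≤ 1 / (m.factorial : ℝ) * |z| ^ m := by
        gcongr
        exact abs_besselE_coeff_le n m
    _ = |z| ^ m / (m.factorial : ℝ) := by ring

theorem hasSum_deriv_besselE (n : ℕ) (z : ℝ) :
    HasSum (fun m : ℕ => (-1 : ℝ) ^ m / ((m.factorial : ℝ) * ((m + n).factorial : ℝ)) *
      (m * z ^ (m - 1))) (-besselE (n + 1) z) := by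
  rw [← hasSum_nat_add_iff' 1]
  convert (hasSum_besselE (n + 1) z).neg using 1
  · funext m
    have h1 : (m.factorial : ℝ) ≠ 0 := by exact_mod_cast m.factorial_ne_zero
    have h2 : ((m + (n + 1)).factorial : ℝ) ≠ 0 := by
      exact_mod_cast (m + (n + 1)).factorial_ne_zero
    have h3 : (m : ℝ) + 1 ≠ 0 := by positivity
    rw [show m + 1 + n = m + (n + 1) by ring, Nat.factorial_succ m, Nat.add_sub_cancel]
    push_cast
    field_simp
    ring
  · simp

theorem hasDerivAt_besselE (n : ℕ) (z : ℝ) : HasDerivAt (besselE n) (-besselE (n + 1) z) z := by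
  set R : ℝ := |z| + 1 with hR
  have hu : Summable fun m : ℕ => 1 / (m.factorial : ℝ) * (m * R ^ (m - 1)) := by
    rw [← summable_nat_add_iff 1]
    refine (Real.summable_pow_div_factorial R).congr fun m => ?_
    have h1 : (m.factorial : ℝ) ≠ 0 := by exact_mod_cast m.factorial_ne_zero
    have h3 : (m : ℝ) + 1 ≠ 0 := by positivity
    rw [Nat.factorial_succ m, Nat.add_sub_cancel]
    push_cast
    field_simp
  have hz : z ∈ Metric.ball (0 : ℝ) R := by simp [hR]
  have h := hasDerivAt_tsum_of_isPreconnected hu Metric.isOpen_ball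
    (convex_ball (0 : ℝ) R).isPreconnected
    (g := fun (m : ℕ) (y : ℝ) =>
      (-1 : ℝ) ^ m / ((m.factorial : ℝ) * ((m + n).factorial : ℝ)) * y ^ m)
    (g' := fun (m : ℕ) (y : ℝ) =>
      (-1 : ℝ) ^ m / ((m.factorial : ℝ) * ((m + n).factorial : ℝ)) * (m * y ^ (m - 1)))
    (fun m y _ => (hasDerivAt_pow m y).const_mul _) (fun m y hy => ?_) hz
    (hasSum_besselE n z).summable hz
  · rw [(hasSum_deriv_besselE n z).tsum_eq] at h
    exact h
  · rw [Metric.mem_ball, dist_zero_right, Real.norm_eq_abs] at hy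
    rw [norm_mul, norm_mul, norm_pow, Real.norm_eq_abs, Real.norm_eq_abs, Real.norm_eq_abs,
      Nat.abs_cast]
    gcongr
    exact abs_besselE_coeff_le n m

theorem besselE_recurrence (n : ℕ) (z : ℝ) :
    besselE n z = (n + 1) * besselE (n + 1) z - z * besselE (n + 2) z := by
  have h := ((hasSum_besselE (n + 1) z).mul_left ((n : ℝ) + 1)).add
    ((hasSum_deriv_besselE (n + 1) z).mul_left z)
  rw [show z * besselE (n + 2) z = -(z * -besselE (n + 1 + 1) z) by ring, sub_neg_eq_add,
    ← h.tsum_eq]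
  refine tsum_congr fun m => ?_
  have h1 : (m.factorial : ℝ) ≠ 0 := by exact_mod_cast m.factorial_ne_zero
  have h2 : ((m + n).factorial : ℝ) ≠ 0 := by exact_mod_cast (m + n).factorial_ne_zero
  have h3 : (m : ℝ) + n + 1 ≠ 0 := by positivity
  have h4 : z * ((m : ℝ) * z ^ (m - 1)) = m * z ^ m := by
    rcases m with _ | m
    · simp
    · rw [Nat.add_sub_cancel, pow_succ]
      ring
  rw [mul_left_comm z, h4, ← add_assoc m n 1, Nat.factorial_succ (m + n)]
  push_cast
  field_simp
  ring

theorem besselE_zero_pos (n : ℕ) : 0 < besselE n 0 := by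
  have h : HasSum (fun m : ℕ => (-1 : ℝ) ^ m / ((m.factorial : ℝ) * ((m + n).factorial : ℝ)) *
      (0 : ℝ) ^ m) (1 / (n.factorial : ℝ)) := by
    convert hasSum_ite_eq 0 (1 / (n.factorial : ℝ)) using 2 with m
    rcases m with _ | m <;> simp
  rw [(hasSum_besselE n 0).unique h]
  positivity

theorem besselJ_eq (n : ℕ) (x : ℝ) : besselJ n x = (x / 2) ^ n * besselE n (x ^ 2 / 4) := by
  rw [besselJ, besselE, ← tsum_mul_left]
  refine tsum_congr fun m => ?_
  rw [pow_add, pow_mul, show (x / 2) ^ 2 = x ^ 2 / 4 by ring]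
  ring

theorem continuous_besselJ (n : ℕ) : Continuous (besselJ n) := by
  have h : Continuous (besselE n) :=
    continuous_iff_continuousAt.2 fun z => (hasDerivAt_besselE n z).continuousAt
  rw [funext (besselJ_eq n)]
  fun_prop

theorem hasDerivAt_besselJ (n : ℕ) {x : ℝ} (hx : x ≠ 0) :
    HasDerivAt (besselJ n) (n / x * besselJ n x - besselJ (n + 1) x) x := by
  have h1 : HasDerivAt (fun y : ℝ => y ^ 2 / 4) (x / 2) x :=
    ((hasDerivAt_pow 2 x).div_const 4).congr_deriv (by push_cast; ring)
  have h2 : HasDerivAt (fun y : ℝ => (y / 2) ^ n) (n * (x / 2) ^ (n - 1) * (1 / 2)) x :=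
    ((hasDerivAt_id x).div_const 2).pow n
  have h3 := h2.mul ((hasDerivAt_besselE n (x ^ 2 / 4)).comp x h1)
  have h4 : (n : ℝ) * (x / 2) ^ (n - 1) * (1 / 2) = n / x * (x / 2) ^ n := by
    rcases n with _ | n
    · simp
    · rw [Nat.add_sub_cancel, pow_succ]
      field_simp
  rw [funext (besselJ_eq n)]
  refine h3.congr_deriv ?_
  rw [h4, besselJ_eq (n + 1), pow_succ]
  simp only [Function.comp]
  ring

theorem besselJ_recurrence (n : ℕ) (x : ℝ) :
    x * (besselJ n x + besselJ (n + 2) x) = 2 * (n + 1) * besselJ (n + 1) x := by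
  rw [besselJ_eq, besselJ_eq, besselJ_eq, besselE_recurrence n, pow_succ, pow_succ]
  ring

theorem hasDerivAt_besselJ_succ (n : ℕ) {x : ℝ} (hx : x ≠ 0) :
    HasDerivAt (besselJ (n + 1)) (besselJ n x - (n + 1) / x * besselJ (n + 1) x) x := by
  refine (hasDerivAt_besselJ (n + 1) hx).congr_deriv ?_
  have h := besselJ_recurrence n x
  push_cast
  field_simp
  linarith

/-- `J_n` is positive immediately to the right of the origin, because
`J_n(x) / (x / 2)^n → 1 / n!`. -/
theorem exists_besselJ_pos (n : ℕ) : ∃ ε > 0, ∀ x, 0 < x → x < ε → 0 < besselJ n x := by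
  have hc : ContinuousAt (fun x : ℝ => besselE n (x ^ 2 / 4)) 0 :=
    ContinuousAt.comp (g := besselE n) (hasDerivAt_besselE n _).continuousAt (by fun_prop)
  have h0 : 0 < besselE n ((0 : ℝ) ^ 2 / 4) := by simpa using besselE_zero_pos n
  obtain ⟨ε, hε, h⟩ := Metric.eventually_nhds_iff.1 (hc.eventually (lt_mem_nhds h0))
  refine ⟨ε, hε, fun x hx hxε => ?_⟩
  rw [besselJ_eq]
  have := @h x (by rwa [dist_zero_right, Real.norm_eq_abs, abs_of_pos hx])
  positivity

/-! ### The Lommel form -/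

/-- The quadratic form `x² J_n'² + (x² - n²) J_n²`, written in terms of `J_n` and `J_{n+1}`. Its
derivative is `2 x J_n²`. -/
noncomputable def lommel (n : ℕ) (x : ℝ) : ℝ :=
  x ^ 2 * (besselJ n x ^ 2 + besselJ (n + 1) x ^ 2) -
    2 * n * x * besselJ n x * besselJ (n + 1) x

theorem hasDerivAt_lommel (n : ℕ) {x : ℝ} (hx : x ≠ 0) :
    HasDerivAt (lommel n) (2 * x * besselJ n x ^ 2) x := by
  have hp := hasDerivAt_besselJ n hx
  have ha := hasDerivAt_besselJ_succ n hx
  have h := ((hasDerivAt_pow 2 x).mul ((hp.pow 2).add (ha.pow 2))).sub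
    ((((hasDerivAt_id x).const_mul (2 * n : ℝ)).mul hp).mul ha)
  refine (h.congr_deriv ?_)
  simp only [Pi.add_apply, Pi.mul_apply, Pi.pow_apply, id]
  push_cast
  field_simp
  ring

/-- The Lommel form vanishes at the origin and is nondecreasing; it cannot stay zero on an
initial interval, where `J_n` is positive. -/
theorem lommel_pos (n : ℕ) {x : ℝ} (hx : 0 < x) : 0 < lommel n x := by
  have hcont : Continuous (lommel n) := by
    have := continuous_besselJ n
    have := continuous_besselJ (n + 1)
    unfold lommel
    fun_prop
  obtain ⟨ε, hε, hpos⟩ := exists_besselJ_pos n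
  set y := min x (ε / 2) with hy
  have hy0 : 0 < y := lt_min hx (by linarith)
  have hyε : y < ε := (min_le_right _ _).trans_lt (by linarith)
  have h1 : StrictMonoOn (lommel n) (Set.Icc 0 y) := by
    refine strictMonoOn_of_deriv_pos (convex_Icc 0 y) hcont.continuousOn fun t ht => ?_
    rw [interior_Icc] at ht
    rw [(hasDerivAt_lommel n ht.1.ne').deriv]
    have := hpos t ht.1 (ht.2.trans hyε)
    have := ht.1
    positivity
  have h2 : MonotoneOn (lommel n) (Set.Ici 0) := by
    refine monotoneOn_of_deriv_nonneg (convex_Ici 0) hcont.continuousOn ?_ fun t ht => ?_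
    · intro t ht
      rw [interior_Ici] at ht
      exact (hasDerivAt_lommel n (ne_of_gt ht)).differentiableAt.differentiableWithinAt
    · rw [interior_Ici] at ht
      rw [(hasDerivAt_lommel n (ne_of_gt ht)).deriv]
      have : (0 : ℝ) < t := ht
      positivity
  calc 0 = lommel n 0 := by simp [lommel]
    _ < lommel n y := h1 (Set.left_mem_Icc.2 hy0.le) (Set.right_mem_Icc.2 hy0.le) hy0
    _ ≤ lommel n x := h2 hy0.le hx.le (min_le_left _ _)

/-- The Lommel form of order `n + 1` in terms of `J_n` and `J_{n+1}`. -/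
theorem lommel_succ (n : ℕ) (x : ℝ) : lommel (n + 1) x =
    x ^ 2 * (besselJ n x ^ 2 + besselJ (n + 1) x ^ 2) -
      2 * (n + 1) * x * besselJ n x * besselJ (n + 1) x := by
  have h := besselJ_recurrence n x
  have h' : x * besselJ (n + 2) x = 2 * (n + 1) * besselJ (n + 1) x - x * besselJ n x := by
    linarith
  have e : lommel (n + 1) x = x ^ 2 * besselJ (n + 1) x ^ 2 + (x * besselJ (n + 2) x) ^ 2 -
      2 * (n + 1) * besselJ (n + 1) x * (x * besselJ (n + 2) x) := by
    rw [lommel]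
    push_cast
    ring
  rw [e, h']
  ring

open Set Real

/-! ### Phases of planar curves -/

/-- `θ` is a phase of the planar curve `(Y, X)` on `(0, ∞)`: a continuous, strictly increasing
polar angle, so that `X` is a positive multiple of `sin θ` and `Y` the same multiple of `cos θ`. -/
structure IsPhase (X Y θ : ℝ → ℝ) : Prop where
  continuousOn : ContinuousOn θ (Ioi 0)
  strictMonoOn : StrictMonoOn θ (Ioi 0)
  polar : ∀ x, 0 < x → ∃ R, 0 < R ∧ X x = R * sin (θ x) ∧ Y x = R * cos (θ x)

/-- A continuously differentiable curve in the punctured plane has a differentiable polar angle.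
The angle is the imaginary part of a primitive of the logarithmic derivative of `Y + i X`. -/
theorem exists_polar_angle {X Y X' Y' : ℝ → ℝ}
    (hX : ∀ x, 0 < x → HasDerivAt X (X' x) x) (hY : ∀ x, 0 < x → HasDerivAt Y (Y' x) x)
    (hX' : ContinuousOn X' (Ioi 0)) (hY' : ContinuousOn Y' (Ioi 0))
    (hne : ∀ x, 0 < x → 0 < X x ^ 2 + Y x ^ 2) :
    ∃ θ : ℝ → ℝ,
      (∀ x, 0 < x → HasDerivAt θ ((X' x * Y x - X x * Y' x) / (X x ^ 2 + Y x ^ 2)) x) ∧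
      ∀ x, 0 < x → ∃ R, 0 < R ∧ X x = R * sin (θ x) ∧ Y x = R * cos (θ x) := by
  set Z : ℝ → ℂ := fun x => Y x + X x * Complex.I with hZ
  set Z' : ℝ → ℂ := fun x => Y' x + X' x * Complex.I with hZ'
  have hdZ : ∀ x, 0 < x → HasDerivAt Z (Z' x) x := fun x hx =>
    (hY x hx).ofReal_comp.add ((hX x hx).ofReal_comp.mul_const Complex.I)
  have hre : ∀ x, (Z x).re = Y x := fun x => by simp [hZ]
  have him : ∀ x, (Z x).im = X x := fun x => by simp [hZ]
  have hnorm : ∀ x, Complex.normSq (Z x) = X x ^ 2 + Y x ^ 2 := fun x => by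
    rw [Complex.normSq_apply, hre, him]
    ring
  have hZne : ∀ x, 0 < x → Z x ≠ 0 := fun x hx h => by
    have := hne x hx
    rw [← hnorm, h, map_zero] at this
    exact lt_irrefl _ this
  have hZc : ContinuousOn Z (Ioi 0) := fun x hx => (hdZ x hx).continuousAt.continuousWithinAt
  have hZ'c : ContinuousOn Z' (Ioi 0) :=
    (Complex.continuous_ofReal.comp_continuousOn hY').add
      ((Complex.continuous_ofReal.comp_continuousOn hX').mul continuousOn_const)
  have hfc : ContinuousOn (fun x => Z' x / Z x) (Ioi 0) := hZ'c.div hZc hZne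
  set L : ℝ → ℂ := fun x => Complex.log (Z 1) + ∫ t in (1 : ℝ)..x, Z' t / Z t with hL
  have hdL : ∀ x, 0 < x → HasDerivAt L (Z' x / Z x) x := fun x hx => by
    refine (intervalIntegral.integral_hasDerivAt_right ?_ ?_ ?_).const_add _
    · refine (hfc.mono fun t ht => ?_).intervalIntegrable
      exact (lt_min one_pos hx).trans_le ht.1
    · exact hfc.stronglyMeasurableAtFilter isOpen_Ioi x hx
    · exact hfc.continuousAt (Ioi_mem_nhds hx)
  have hdG : ∀ x, 0 < x → HasDerivAt (fun x => Z x * Complex.exp (-L x)) 0 x := fun x hx => by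
    refine ((hdZ x hx).mul (hdL x hx).neg.cexp).congr_deriv ?_
    have := hZne x hx
    field_simp
    ring
  have hexp : ∀ x, 0 < x → Z x = Complex.exp (L x) := fun x hx => by
    have h : Z x * Complex.exp (-L x) = Z 1 * Complex.exp (-L 1) :=
      isOpen_Ioi.is_const_of_deriv_eq_zero isPreconnected_Ioi
        (fun t ht => (hdG t ht).differentiableAt.differentiableWithinAt)
        (fun t ht => (hdG t ht).deriv) hx (mem_Ioi.2 one_pos)
    have h1 : L 1 = Complex.log (Z 1) := by simp [hL]
    rw [h1, Complex.exp_neg (L x), Complex.exp_neg, Complex.exp_log (hZne 1 one_pos),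
      mul_inv_cancel₀ (hZne 1 one_pos), mul_inv_eq_one₀ (Complex.exp_ne_zero _)] at h
    exact h
  refine ⟨fun x => (L x).im, fun x hx => ?_, fun x hx => ⟨exp (L x).re, exp_pos _, ?_, ?_⟩⟩
  · refine (Complex.imCLM.hasFDerivAt.comp_hasDerivAt x (hdL x hx)).congr_deriv ?_
    have hre' : (Z' x).re = Y' x := by simp [hZ']
    have him' : (Z' x).im = X' x := by simp [hZ']
    rw [Complex.imCLM_apply, Complex.div_im, hnorm, hre, him, hre', him']
    ring
  · rw [← him, hexp x hx, Complex.exp_im]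
  · rw [← hre, hexp x hx, Complex.exp_re]

theorem exists_isPhase {X Y X' Y' : ℝ → ℝ}
    (hX : ∀ x, 0 < x → HasDerivAt X (X' x) x) (hY : ∀ x, 0 < x → HasDerivAt Y (Y' x) x)
    (hX' : ContinuousOn X' (Ioi 0)) (hY' : ContinuousOn Y' (Ioi 0))
    (hW : ∀ x, 0 < x → 0 < X' x * Y x - X x * Y' x) : ∃ θ, IsPhase X Y θ := by
  have hne : ∀ x, 0 < x → 0 < X x ^ 2 + Y x ^ 2 := fun x hx => by
    by_contra h
    have h1 : X x = 0 := by nlinarith [sq_nonneg (X x), sq_nonneg (Y x)]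
    have h2 : Y x = 0 := by nlinarith [sq_nonneg (X x), sq_nonneg (Y x)]
    have := hW x hx
    rw [h1, h2] at this
    simp at this
  obtain ⟨θ, hd, hp⟩ := exists_polar_angle hX hY hX' hY' hne
  have hc : ContinuousOn θ (Ioi 0) := fun x hx => (hd x hx).continuousAt.continuousWithinAt
  refine ⟨θ, hc, strictMonoOn_of_deriv_pos (convex_Ioi 0) hc fun x hx => ?_, hp⟩
  rw [interior_Ioi] at hx
  rw [(hd x hx).deriv]
  exact div_pos (hW x hx) (hne x hx)

namespace IsPhase

variable {X Y θ : ℝ → ℝ}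

theorem cross_eq (h : IsPhase X Y θ) {x y : ℝ} (hx : 0 < x) (hy : 0 < y) :
    ∃ R, 0 < R ∧ X x * Y y - X y * Y x = R * sin (θ x - θ y) := by
  obtain ⟨R, hR, h1, h2⟩ := h.polar x hx
  obtain ⟨S, hS, h3, h4⟩ := h.polar y hy
  refine ⟨R * S, mul_pos hR hS, ?_⟩
  rw [h1, h2, h3, h4, sin_sub]
  ring

theorem eq_zero_iff (h : IsPhase X Y θ) {x : ℝ} (hx : 0 < x) : X x = 0 ↔ sin (θ x) = 0 := by
  obtain ⟨R, hR, h1, -⟩ := h.polar x hx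
  rw [h1, mul_eq_zero, or_iff_right hR.ne']

theorem exists_eq (h : IsPhase X Y θ) {x y c : ℝ} (hx : 0 < x) (hxy : x ≤ y) (hc : θ x < c)
    (hc' : c ≤ θ y) : ∃ z, x < z ∧ z ≤ y ∧ θ z = c := by
  obtain ⟨z, hz, hzc⟩ := intermediate_value_Icc hxy
    (h.continuousOn.mono fun t ht => hx.trans_le ht.1) ⟨hc.le, hc'⟩
  refine ⟨z, lt_of_le_of_ne hz.1 ?_, hz.2, hzc⟩
  rintro rfl
  exact hc.ne hzc

theorem pi_le_sub_of_zeros (h : IsPhase X Y θ) {x y : ℝ} (hx : 0 < x) (hxy : x < y)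
    (h1 : X x = 0) (h2 : X y = 0) : π ≤ θ y - θ x := by
  obtain ⟨m, hm⟩ := sin_eq_zero_iff.1 ((h.eq_zero_iff hx).1 h1)
  obtain ⟨n, hn⟩ := sin_eq_zero_iff.1 ((h.eq_zero_iff (hx.trans hxy)).1 h2)
  have hlt := h.strictMonoOn hx (hx.trans hxy) hxy
  rw [← hm, ← hn, mul_lt_mul_iff_left₀ pi_pos] at hlt
  have hle : (m : ℝ) + 1 ≤ n := by exact_mod_cast Int.add_one_le_iff.2 (by exact_mod_cast hlt)
  rw [← hm, ← hn]
  nlinarith [pi_pos]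

theorem zero_of_sub_eq_pi (h : IsPhase X Y θ) {x y : ℝ} (hx : 0 < x) (hy : 0 < y)
    (hxy : θ y - θ x = π) : X x = 0 ↔ X y = 0 := by
  rw [h.eq_zero_iff hx, h.eq_zero_iff hy, show θ y = θ x + π by linarith, sin_add_pi,
    neg_eq_zero]

/-- Consecutive zeros of `X` are exactly half a turn apart. -/
theorem sub_eq_pi_of_isLeast (h : IsPhase X Y θ) {x y : ℝ} (hx : 0 < x) (h1 : X x = 0)
    (h2 : IsLeast {z | x < z ∧ X z = 0} y) : θ y - θ x = π := by
  have hxy : x < y := h2.1.1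
  refine le_antisymm ?_ (h.pi_le_sub_of_zeros hx hxy h1 h2.1.2)
  by_contra! hlt
  obtain ⟨z, hxz, hzy, hz⟩ := h.exists_eq hx hxy.le (c := θ x + π) (by linarith [pi_pos])
    (by linarith)
  have hXz : X z = 0 := (h.zero_of_sub_eq_pi hx (hx.trans hxz) (by linarith)).1 h1
  rw [le_antisymm hzy (h2.2 ⟨hxz, hXz⟩)] at hz
  linarith

theorem isLeast_of_sub_eq_pi (h : IsPhase X Y θ) {x y : ℝ} (hx : 0 < x) (hy : 0 < y)
    (h1 : X x = 0) (h2 : θ y - θ x = π) : IsLeast {z | x < z ∧ X z = 0} y := by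
  refine ⟨⟨(h.strictMonoOn.lt_iff_lt hx hy).1 (by linarith [pi_pos]),
    (h.zero_of_sub_eq_pi hx hy h2).1 h1⟩, fun z hz => ?_⟩
  refine (h.strictMonoOn.le_iff_le hy (hx.trans hz.1)).1 ?_
  linarith [h.pi_le_sub_of_zeros hx hz.1 h1 hz.2]

/-- If `X` has arbitrarily large zeros, the phase is unbounded. -/
theorem exists_le (h : IsPhase X Y θ) (hz : ∀ M, ∃ x, M < x ∧ X x = 0) {x : ℝ} (hx : 0 < x)
    (c : ℝ) : ∃ y, x < y ∧ c ≤ θ y := by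
  have step : ∀ n : ℕ, ∃ y, x < y ∧ θ x + n * π ≤ θ y := by
    intro n
    induction n with
    | zero => exact ⟨x + 1, by linarith, by
        simpa using (h.strictMonoOn hx (mem_Ioi.2 (by linarith)) (by linarith : x < x + 1)).le⟩
    | succ n ih =>
      obtain ⟨y, hxy, hy⟩ := ih
      obtain ⟨z, hyz, hz0⟩ := hz y
      obtain ⟨w, hzw, hw0⟩ := hz z
      have hy0 : 0 < y := hx.trans hxy
      have hz1 : 0 < z := hy0.trans hyz
      refine ⟨w, hxy.trans (hyz.trans hzw), ?_⟩
      have h1 := h.pi_le_sub_of_zeros hz1 hzw hz0 hw0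
      have h2 := h.strictMonoOn hy0 hz1 hyz
      push_cast
      linarith
  obtain ⟨n, hn⟩ := exists_nat_ge ((c - θ x) / π)
  obtain ⟨y, hxy, hy⟩ := step n
  rw [div_le_iff₀ pi_pos] at hn
  exact ⟨y, hxy, by linarith⟩

theorem exists_isLeast_zero (h : IsPhase X Y θ) (hz : ∀ M, ∃ x, M < x ∧ X x = 0) {x : ℝ}
    (hx : 0 < x) (h1 : X x = 0) : ∃ y, IsLeast {z | x < z ∧ X z = 0} y := by
  obtain ⟨w, hxw, hw⟩ := h.exists_le hz hx (θ x + π)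
  obtain ⟨y, hxy, -, hy⟩ := h.exists_eq hx hxw.le (c := θ x + π) (by linarith [pi_pos]) hw
  exact ⟨y, h.isLeast_of_sub_eq_pi hx (hx.trans hxy) h1 (by linarith)⟩

/-! ### The first root of the cross product at `α` and `κ / α` -/

theorem sub_lt_sub (h : IsPhase X Y θ) {κ a b : ℝ} (hκ : 0 < κ) (ha : 0 < a) (hab : a < b) :
    θ a - θ (κ / a) < θ b - θ (κ / b) := by
  have hb := ha.trans hab
  have h1 := h.strictMonoOn ha hb hab
  have h2 := h.strictMonoOn (mem_Ioi.2 (div_pos hκ hb)) (mem_Ioi.2 (div_pos hκ ha))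
    (div_lt_div_of_pos_left hκ ha hab)
  linarith

theorem exists_sub_eq_pi (h : IsPhase X Y θ) (hz : ∀ M, ∃ x, M < x ∧ X x = 0) {κ : ℝ}
    (hκ : 0 < κ) : ∃ a, √κ < a ∧ θ a - θ (κ / a) = π := by
  have hs : 0 < √κ := sqrt_pos.2 hκ
  obtain ⟨b, hb, hbc⟩ := h.exists_le hz hs (θ (√κ) + π)
  have hc : ContinuousOn (fun a => θ a - θ (κ / a)) (Icc (√κ) b) := by
    have h1 : ContinuousOn (fun a : ℝ => κ / a) (Icc (√κ) b) :=
      continuousOn_const.div continuousOn_id fun t ht => (hs.trans_le ht.1).ne'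
    exact (h.continuousOn.mono fun t ht => hs.trans_le ht.1).sub
      (h.continuousOn.comp h1 fun t ht => div_pos hκ (hs.trans_le ht.1))
  have hle : θ (κ / b) ≤ θ (√κ) := by
    refine (h.strictMonoOn.le_iff_le (mem_Ioi.2 (div_pos hκ (hs.trans hb))) hs).2 ?_
    rw [div_le_iff₀ (hs.trans hb)]
    nlinarith [mul_self_sqrt hκ.le]
  have h0 : θ (√κ) - θ (κ / √κ) = 0 := by rw [div_sqrt, sub_self]
  obtain ⟨a, ha, hac⟩ := intermediate_value_Icc hb.le hc
    (show π ∈ Icc (θ (√κ) - θ (κ / √κ)) (θ b - θ (κ / b)) from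
      ⟨by rw [h0]; exact pi_pos.le, by linarith⟩)
  refine ⟨a, lt_of_le_of_ne ha.1 ?_, hac⟩
  rintro rfl
  exact pi_ne_zero (hac.symm.trans h0)

/-- The first root beyond `√κ` of the cross product of the curve at `α` and at `κ / α` is the
point where the phase difference, which increases from `0`, reaches `π`. -/
theorem isLeast_root (h : IsPhase X Y θ) {κ a C : ℝ} (hκ : 0 < κ) {G : ℝ → ℝ}
    (hC : C ≠ 0) (hG : ∀ x, 0 < x → G x = C * (X x * Y (κ / x) - X (κ / x) * Y x)) (ha : √κ < a)
    (hac : θ a - θ (κ / a) = π) : IsLeast {x | √κ < x ∧ G x = 0} a := by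
  have hs : 0 < √κ := sqrt_pos.2 hκ
  have hG' : ∀ x, √κ < x → (G x = 0 ↔ sin (θ x - θ (κ / x)) = 0) := fun x hx => by
    have hx0 := hs.trans hx
    obtain ⟨R, hR, he⟩ := h.cross_eq hx0 (div_pos hκ hx0)
    rw [hG x hx0, he, mul_eq_zero, or_iff_right hC, mul_eq_zero, or_iff_right hR.ne']
  refine ⟨⟨ha, (hG' a ha).2 (by rw [hac, sin_pi])⟩, fun x hx => ?_⟩
  by_contra! hlt
  have h1 := h.sub_lt_sub hκ (hs.trans hx.1) hlt
  have h0 := h.sub_lt_sub hκ hs hx.1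
  rw [div_sqrt, sub_self] at h0
  exact (sin_pos_of_pos_of_lt_pi h0 (h1.trans_eq hac)).ne' ((hG' x hx.1).1 hx.2)

/-! ### Shearing a curve -/

/-- Shearing a curve by `Y ↦ Y - c X` with `c > 0` advances its phase, up to a constant, by an
angle in `[0, π)`. The sine of the advance is nonnegative, and where it vanishes `X` vanishes and
the cosine equals `1`. -/
theorem exists_shear_bounds (h : IsPhase X Y θ) {Y₂ θ₂ c : ℝ → ℝ} (h₂ : IsPhase X Y₂ θ₂)
    (hc : ∀ x, 0 < x → 0 < c x) (hY : ∀ x, 0 < x → Y₂ x = Y x - c x * X x) :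
    ∃ d, ∀ x, 0 < x → d ≤ θ₂ x - θ x ∧ θ₂ x - θ x < d + π := by
  set δ : ℝ → ℝ := fun x => θ₂ x - θ x with hδ
  have hδc : ContinuousOn δ (Ioi 0) := h₂.continuousOn.sub h.continuousOn
  have hsin : ∀ x, 0 < x → 0 ≤ sin (δ x) ∧ (sin (δ x) = 0 → X x = 0) := fun x hx => by
    obtain ⟨R, hR, h1, h2⟩ := h.polar x hx
    obtain ⟨S, hS, h3, h4⟩ := h₂.polar x hx
    have he : R * S * sin (δ x) = c x * X x ^ 2 := by
      calc R * S * sin (δ x) = (S * sin (θ₂ x)) * (R * cos (θ x)) -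
            (S * cos (θ₂ x)) * (R * sin (θ x)) := by
            rw [hδ, sin_sub]
            ring
        _ = c x * X x ^ 2 := by
            rw [← h1, ← h2, ← h3, ← h4, hY x hx]
            ring
    have hc0 := hc x hx
    constructor
    · have : 0 ≤ R * S * sin (δ x) := by rw [he]; positivity
      exact nonneg_of_mul_nonneg_right this (mul_pos hR hS)
    · intro h0
      rw [h0, mul_zero] at he
      have := he.symm
      simpa [hc0.ne'] using this
  have hcos : ∀ x, 0 < x → X x = 0 → cos (δ x) = 1 := fun x hx h0 => by
    obtain ⟨R, hR, h1, h2⟩ := h.polar x hx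
    obtain ⟨S, hS, h3, h4⟩ := h₂.polar x hx
    have hs1 : sin (θ x) = 0 := (h.eq_zero_iff hx).1 h0
    have hs2 : sin (θ₂ x) = 0 := (h₂.eq_zero_iff hx).1 h0
    have he : S * cos (θ₂ x) = R * cos (θ x) := by
      rw [← h2, ← h4, hY x hx, h0]
      ring
    have hq1 : cos (θ x) ^ 2 = 1 := by nlinarith [sin_sq_add_cos_sq (θ x)]
    have hsd : sin (δ x) = 0 := by rw [hδ, sin_sub, hs1, hs2]; ring
    have hcd : 0 < cos (δ x) := by
      have : S * cos (δ x) = R := by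
        rw [hδ, cos_sub, hs2, zero_mul, add_zero, ← mul_assoc, he, mul_assoc, ← sq, hq1, mul_one]
      exact pos_of_mul_pos_right (this ▸ hR) hS.le
    nlinarith [sin_sq_add_cos_sq (δ x)]
  -- The difference of the phases never is an odd multiple of `π`.
  have hodd : ∀ x, 0 < x → ∀ n : ℤ, δ x ≠ n * (2 * π) + π := fun x hx n he => by
    have h0 : sin (δ x) = 0 := by
      rw [he, sin_add_pi, neg_eq_zero, sin_eq_zero_iff]
      exact ⟨2 * n, by push_cast; ring⟩
    have h1 := hcos x hx ((hsin x hx).2 h0)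
    rw [he, cos_add_pi, cos_int_mul_two_pi] at h1
    linarith
  have hconn : OrdConnected (δ '' Ioi 0) := (isPreconnected_Ioi.image δ hδc).ordConnected
  set n : ℤ := ⌊(δ 1 + π) / (2 * π)⌋ with hn
  have hn1 : n * (2 * π) - π ≤ δ 1 := by
    have := Int.floor_le ((δ 1 + π) / (2 * π))
    rw [le_div_iff₀ two_pi_pos] at this
    linarith
  have hn2 : δ 1 < n * (2 * π) + π := by
    have := Int.lt_floor_add_one ((δ 1 + π) / (2 * π))
    rw [div_lt_iff₀ two_pi_pos] at this
    linarith
  have hup : ∀ x, 0 < x → δ x < n * (2 * π) + π := fun x hx => by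
    by_contra! hle
    obtain ⟨y, hy, he⟩ := hconn.out (mem_image_of_mem δ (mem_Ioi.2 one_pos))
      (mem_image_of_mem δ (mem_Ioi.2 hx)) ⟨hn2.le, hle⟩
    exact hodd y hy n he
  have hlow : ∀ x, 0 < x → n * (2 * π) - π < δ x := fun x hx => by
    by_contra! hle
    obtain ⟨y, hy, he⟩ := hconn.out (mem_image_of_mem δ (mem_Ioi.2 hx))
      (mem_image_of_mem δ (mem_Ioi.2 one_pos)) ⟨hle, hn1⟩
    refine hodd y hy (n - 1) (he.trans ?_)
    push_cast
    ring
  have hge : ∀ x, 0 < x → n * (2 * π) ≤ δ x := fun x hx => by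
    by_contra! hlt
    have h1 : sin (δ x - n * (2 * π)) < 0 :=
      sin_neg_of_neg_of_neg_pi_lt (by linarith) (by linarith [hlow x hx])
    rw [sin_sub_int_mul_two_pi] at h1
    exact h1.not_ge (hsin x hx).1
  exact ⟨n * (2 * π), fun x hx => ⟨hge x hx, hup x hx⟩⟩

/-- Let the curve turn by exactly `π` from `y` to `x`. If the shear coefficient decreases, then
the sheared curve turns by less than `π`, unless `X x = 0`. Indeed the cross product of the
sheared curve at `x` and `y` equals `(c x - c y) X x X y`, where `X x` and `X y` have opposite
signs. -/
theorem shear_sub_lt_pi (h : IsPhase X Y θ) {Y₂ θ₂ c : ℝ → ℝ} (h₂ : IsPhase X Y₂ θ₂)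
    (hc : ∀ x, 0 < x → 0 < c x) (hY : ∀ x, 0 < x → Y₂ x = Y x - c x * X x)
    {x y : ℝ} (hy : 0 < y) (hyx : y < x) (hcxy : c x < c y) (hθ : θ x - θ y = π)
    (hX : X x ≠ 0) : θ₂ x - θ₂ y < π := by
  have hx := hy.trans hyx
  obtain ⟨d, hd⟩ := h.exists_shear_bounds h₂ hc hY
  have hneg : X x * X y < 0 := by
    obtain ⟨R, hR, h1, -⟩ := h.polar x hx
    obtain ⟨S, hS, h3, -⟩ := h.polar y hy
    rw [show θ x = θ y + π by linarith, sin_add_pi] at h1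
    have hs : sin (θ y) ≠ 0 := fun h0 => hX (by rw [h1, h0]; ring)
    have : 0 < R * S * sin (θ y) ^ 2 := by positivity
    rw [h1, h3]
    linarith
  obtain ⟨R, hR, he⟩ := h.cross_eq hx hy
  obtain ⟨S, hS, he₂⟩ := h₂.cross_eq hx hy
  rw [hθ, sin_pi, mul_zero] at he
  have hpos : 0 < S * sin (θ₂ x - θ₂ y) := by
    calc 0 < X x * X y * (c x - c y) := mul_pos_of_neg_of_neg hneg (by linarith)
      _ = X x * Y₂ y - X y * Y₂ x := by
        rw [hY x hx, hY y hy]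
        linarith
      _ = S * sin (θ₂ x - θ₂ y) := he₂
  have hsin : 0 < sin (θ₂ x - θ₂ y) := pos_of_mul_pos_right hpos hS.le
  by_contra! hle
  have h1 : 0 ≤ sin (θ₂ x - θ₂ y - π) :=
    sin_nonneg_of_nonneg_of_le_pi (by linarith) (by linarith [(hd x hx).2, (hd y hy).1])
  rw [sin_sub_pi] at h1
  linarith

end IsPhase

/-! ### Phases attached to Bessel functions -/

theorem deriv_formula_continuousOn (c : ℝ) (m n : ℕ) :
    ContinuousOn (fun x => c / x * besselJ m x - besselJ n x) (Ioi 0) :=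
  ((continuousOn_const.div continuousOn_id fun _ hx => ne_of_gt hx).mul
    (continuous_besselJ m).continuousOn).sub (continuous_besselJ n).continuousOn

theorem besselJ_sq_add_sq_pos (n : ℕ) {x : ℝ} (hx : 0 < x) :
    0 < besselJ (n + 1) x ^ 2 + besselJ n x ^ 2 := by
  by_contra h
  have h1 : besselJ (n + 1) x = 0 := by
    nlinarith [sq_nonneg (besselJ (n + 1) x), sq_nonneg (besselJ n x)]
  have h2 : besselJ n x = 0 := by
    nlinarith [sq_nonneg (besselJ (n + 1) x), sq_nonneg (besselJ n x)]
  have h3 := lommel_pos n hx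
  rw [lommel, h1, h2] at h3
  simp at h3

/-- `J_{n+1}` has arbitrarily large zeros: the polar angle of the curve `(J_n, J_{n+1})` has
derivative `1 - (2n + 1) J_n J_{n+1} / (x (J_n² + J_{n+1}²))`, which is at least `1 / 2` for
`x ≥ 2n + 1`. -/
theorem exists_besselJ_succ_zero_gt (n : ℕ) (M : ℝ) : ∃ x, M < x ∧ besselJ (n + 1) x = 0 := by
  have hc1 : ContinuousOn (fun x => besselJ n x - (n + 1) / x * besselJ (n + 1) x) (Ioi 0) := by
    refine (deriv_formula_continuousOn (n + 1) (n + 1) n).neg.congr fun x _ => ?_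
    simp
  obtain ⟨θ, hd, hp⟩ := exists_polar_angle
    (fun x hx => hasDerivAt_besselJ_succ n (ne_of_gt hx))
    (fun x hx => hasDerivAt_besselJ n (ne_of_gt hx)) hc1
    (deriv_formula_continuousOn n n (n + 1)) (fun x hx => besselJ_sq_add_sq_pos n hx)
  set x₀ : ℝ := max M (2 * n + 1) with hx₀
  have hx₀n : (2 * n + 1 : ℝ) ≤ x₀ := le_max_right _ _
  have hpos : 0 < x₀ := lt_of_lt_of_le (by positivity) hx₀n
  have hcont : ContinuousOn θ (Ici x₀) := fun x hx =>
    (hd x (hpos.trans_le hx)).continuousAt.continuousWithinAt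
  have hder : ∀ x ∈ interior (Ici x₀), 1 / 2 ≤ deriv θ x := fun x hx => by
    rw [interior_Ici] at hx
    have hx0 : 0 < x := hpos.trans hx
    have hs := besselJ_sq_add_sq_pos n hx0
    rw [(hd x hx0).deriv, le_div_iff₀ hs]
    have hq : (2 * n + 1 : ℝ) / x ≤ 1 := (div_le_one hx0).2 (hx₀n.trans (le_of_lt hx))
    have hq0 : (0 : ℝ) ≤ (2 * n + 1 : ℝ) / x := by positivity
    have hab : (2 * n + 1 : ℝ) / x * (besselJ n x * besselJ (n + 1) x) ≤
        (besselJ (n + 1) x ^ 2 + besselJ n x ^ 2) / 2 := by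
      nlinarith [sq_nonneg (besselJ n x - besselJ (n + 1) x)]
    have he : (besselJ n x - (n + 1) / x * besselJ (n + 1) x) * besselJ n x -
        besselJ (n + 1) x * (n / x * besselJ n x - besselJ (n + 1) x) =
        besselJ (n + 1) x ^ 2 + besselJ n x ^ 2 -
          (2 * n + 1 : ℝ) / x * (besselJ n x * besselJ (n + 1) x) := by
      ring
    rw [he]
    linarith
  have hgrow : ∀ y, x₀ ≤ y → 1 / 2 * (y - x₀) ≤ θ y - θ x₀ := fun y hy =>
    (convex_Ici x₀).mul_sub_le_image_sub_of_le_deriv hcont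
      (fun x hx =>
        (hd x (hpos.trans_le (interior_subset hx))).differentiableAt.differentiableWithinAt)
      hder x₀ self_mem_Ici y hy hy
  obtain ⟨m, hm⟩ := exists_nat_gt (θ x₀ / π)
  rw [div_lt_iff₀ pi_pos] at hm
  set y : ℝ := x₀ + 2 * (m * π - θ x₀) with hy
  have hxy : x₀ ≤ y := by linarith
  obtain ⟨z, hz, hzm⟩ := intermediate_value_Icc hxy (hcont.mono Icc_subset_Ici_self)
    (show (m : ℝ) * π ∈ Icc (θ x₀) (θ y) from ⟨hm.le, by linarith [hgrow y hxy]⟩)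
  refine ⟨z, lt_of_le_of_ne ((le_max_left _ _).trans hz.1) ?_, ?_⟩
  · intro hMz
    have : z = x₀ := le_antisymm (hMz ▸ le_max_left _ _) hz.1
    rw [this] at hzm
    exact hm.ne hzm
  · obtain ⟨R, -, hR, -⟩ := hp z (hpos.trans_le hz.1)
    rw [hR, hzm, sin_nat_mul_pi, mul_zero]

/-- The Wronskian of this curve is the Lommel form of order `n` divided by `x³`. -/
theorem exists_isPhase_div (n : ℕ) :
    ∃ θ, IsPhase (besselJ (n + 1)) (fun x => besselJ n x / x) θ := by
  have hd : ∀ x : ℝ, 0 < x → HasDerivAt (fun x => besselJ n x / x)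
      (((n / x * besselJ n x - besselJ (n + 1) x) * x - besselJ n x * 1) / x ^ 2) x := fun x hx =>
    (hasDerivAt_besselJ n hx.ne').div (hasDerivAt_id x) hx.ne'
  refine exists_isPhase (fun x hx => hasDerivAt_besselJ_succ n (ne_of_gt hx)) hd ?_ ?_
    fun x hx => ?_
  · refine (deriv_formula_continuousOn (n + 1) (n + 1) n).neg.congr fun x _ => ?_
    simp
  · exact (((deriv_formula_continuousOn n n (n + 1)).mul continuousOn_id).sub
      ((continuous_besselJ n).continuousOn.mul continuousOn_const)).div (by fun_prop)
      fun x hx => pow_ne_zero 2 (ne_of_gt hx)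
  · have h := div_pos (lommel_pos n hx) (pow_pos hx 3)
    refine h.trans_eq ?_
    rw [lommel]
    field_simp
    ring

/-- The Wronskian of this curve is the Lommel form of order `n + 1` divided by `x`. -/
theorem exists_isPhase_mul (n : ℕ) :
    ∃ θ, IsPhase (besselJ (n + 1)) (fun x => x * besselJ n x) θ := by
  have hd : ∀ x : ℝ, 0 < x → HasDerivAt (fun x => x * besselJ n x)
      (1 * besselJ n x + x * (n / x * besselJ n x - besselJ (n + 1) x)) x := fun x hx =>
    (hasDerivAt_id x).mul (hasDerivAt_besselJ n hx.ne')
  refine exists_isPhase (fun x hx => hasDerivAt_besselJ_succ n (ne_of_gt hx)) hd ?_ ?_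
    fun x hx => ?_
  · refine (deriv_formula_continuousOn (n + 1) (n + 1) n).neg.congr fun x _ => ?_
    simp
  · exact (continuousOn_const.mul (continuous_besselJ n).continuousOn).add
      (continuousOn_id.mul (deriv_formula_continuousOn n n (n + 1)))
  · have h := div_pos (lommel_pos (n + 1) hx) hx
    refine h.trans_eq ?_
    rw [lommel_succ]
    field_simp
    ring

/-- The Wronskian of this curve is the Lommel form of order `n + 1` divided by `x³`. -/
theorem exists_isPhase_neg_div (n : ℕ) :
    ∃ θ, IsPhase (besselJ n) (fun x => -besselJ (n + 1) x / x) θ := by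
  have hd : ∀ x : ℝ, 0 < x → HasDerivAt (fun x => -besselJ (n + 1) x / x)
      ((-(besselJ n x - (n + 1) / x * besselJ (n + 1) x) * x - -besselJ (n + 1) x * 1) / x ^ 2)
      x := fun x hx => (hasDerivAt_besselJ_succ n hx.ne').neg.div (hasDerivAt_id x) hx.ne'
  refine exists_isPhase (fun x hx => hasDerivAt_besselJ n (ne_of_gt hx)) hd
    (deriv_formula_continuousOn n n (n + 1)) ?_ fun x hx => ?_
  · refine ((ContinuousOn.mul ?_ continuousOn_id).sub
      ((continuous_besselJ (n + 1)).neg.continuousOn.mul continuousOn_const)).div (by fun_prop)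
      fun x hx => pow_ne_zero 2 (ne_of_gt hx)
    refine (deriv_formula_continuousOn (n + 1) (n + 1) n).congr fun x _ => ?_
    simp
  · have h := div_pos (lommel_pos (n + 1) hx) (pow_pos hx 3)
    refine h.trans_eq ?_
    rw [lommel_succ]
    field_simp
    ring

theorem F_eq (n : ℕ) {κ x : ℝ} (hκ : 0 < κ) (hx : 0 < x) : F n κ x =
    κ * (besselJ (n + 1) x * (besselJ n (κ / x) / (κ / x)) -
      besselJ (n + 1) (κ / x) * (besselJ n x / x)) := by
  rw [F, (hasDerivAt_besselJ n hx.ne').deriv, (hasDerivAt_besselJ n (div_pos hκ hx).ne').deriv]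
  field_simp
  ring

theorem F_succ_eq (n : ℕ) {κ x : ℝ} (hκ : 0 < κ) (hx : 0 < x) : F (n + 1) κ x =
    besselJ (n + 1) x * (κ / x * besselJ n (κ / x)) -
      besselJ (n + 1) (κ / x) * (x * besselJ n x) := by
  rw [F, (hasDerivAt_besselJ_succ n hx.ne').deriv,
    (hasDerivAt_besselJ_succ n (div_pos hκ hx).ne').deriv]
  field_simp
  ring

/-! ### Enumeration of the zeros of the Bessel function -/

theorem besselZero_one_isLeast (k : ℕ) :
    IsLeast {x : ℝ | 0 < x ∧ besselJ (k + 1) x = 0} (besselZero (k + 1) 1) := by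
  obtain ⟨ε, hε, hpos⟩ := exists_besselJ_pos (k + 1)
  have he : {x : ℝ | 0 < x ∧ besselJ (k + 1) x = 0} = Ici ε ∩ besselJ (k + 1) ⁻¹' {0} := by
    ext x
    constructor
    · rintro ⟨h1, h2⟩
      exact ⟨not_lt.1 fun h => (hpos x h1 h).ne' h2, h2⟩
    · rintro ⟨h1, h2⟩
      exact ⟨hε.trans_le h1, h2⟩
  have hclosed : IsClosed {x : ℝ | 0 < x ∧ besselJ (k + 1) x = 0} := by
    rw [he]
    exact isClosed_Ici.inter (isClosed_singleton.preimage (continuous_besselJ _))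
  exact hclosed.isLeast_csInf (exists_besselJ_succ_zero_gt k 0) ⟨0, fun x hx => hx.1.le⟩

theorem besselZero_isLeast (k n : ℕ) : 0 ≤ besselZero (k + 1) n ∧
    IsLeast {x : ℝ | besselZero (k + 1) n < x ∧ besselJ (k + 1) x = 0}
      (besselZero (k + 1) (n + 1)) := by
  induction n with
  | zero => exact ⟨le_rfl, besselZero_one_isLeast k⟩
  | succ n ih =>
    have hpos : 0 < besselZero (k + 1) (n + 1) := ih.1.trans_lt ih.2.1.1
    obtain ⟨θ, hθ⟩ := exists_isPhase_mul k
    obtain ⟨y, hy⟩ := hθ.exists_isLeast_zero (exists_besselJ_succ_zero_gt k) hpos ih.2.1.2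
    have he : besselZero (k + 1) (n + 1 + 1) = y := hy.csInf_eq
    exact ⟨hpos.le, he ▸ hy⟩

theorem besselZero_pos (k : ℕ) {n : ℕ} (hn : 1 ≤ n) : 0 < besselZero (k + 1) n := by
  obtain ⟨m, rfl⟩ := Nat.exists_eq_add_of_le' hn
  exact (besselZero_isLeast k m).1.trans_lt (besselZero_isLeast k m).2.1.1

theorem besselJ_besselZero (k : ℕ) {n : ℕ} (hn : 1 ≤ n) :
    besselJ (k + 1) (besselZero (k + 1) n) = 0 := by
  obtain ⟨m, rfl⟩ := Nat.exists_eq_add_of_le' hn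
  exact (besselZero_isLeast k m).2.1.2

/-- Every positive zero of `J_{k+1}` occurs in the enumeration. Otherwise all enumerated zeros lie
below it, whereas the phase grows by `π` from each of them to the next. -/
theorem exists_besselZero_eq (k : ℕ) {x : ℝ} (hx : 0 < x) (h0 : besselJ (k + 1) x = 0) :
    ∃ n, 1 ≤ n ∧ besselZero (k + 1) n = x := by
  by_contra! hne
  obtain ⟨θ, hθ⟩ := exists_isPhase_mul k
  have hlt : ∀ n, besselZero (k + 1) n < x := by
    intro n
    induction n with
    | zero => exact hx
    | succ n ih =>
      exact lt_of_le_of_ne ((besselZero_isLeast k n).2.2 ⟨ih, h0⟩) (hne (n + 1) (by omega))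
  have hθn : ∀ n : ℕ, θ (besselZero (k + 1) (n + 1)) = θ (besselZero (k + 1) 1) + n * π := by
    intro n
    induction n with
    | zero => simp
    | succ n ih =>
      have h1 : 1 ≤ n + 1 := by omega
      have := hθ.sub_eq_pi_of_isLeast (besselZero_pos k h1) (besselJ_besselZero k h1)
        (besselZero_isLeast k (n + 1)).2
      push_cast
      linarith
  obtain ⟨n, hn⟩ := exists_nat_gt ((θ x - θ (besselZero (k + 1) 1)) / π)
  rw [div_lt_iff₀ pi_pos] at hn
  have h1 := hθ.strictMonoOn (besselZero_pos k (by omega : 1 ≤ n + 1)) hx (hlt (n + 1))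
  linarith [hθn n]

end Buckling

/-! ### Comparison of the first roots -/

open Buckling

/-- The first two conjuncts record that the numbers `α_{k,1}(κ)` and `j_{k+1,n}` really are
the roots they are named after, i.e. that the infima defining them are attained. -/
theorem mainTheorem9 (k : ℕ) (κ : ℝ) (hκ : 0 < κ) :
    IsLeast {a : ℝ | Real.sqrt κ < a ∧ Buckling.F k κ a = 0} (Buckling.alpha k 1 κ) ∧
    (∀ n : ℕ, IsLeast {x : ℝ | Buckling.besselZero (k + 1) n < x ∧ Buckling.besselJ (k + 1) x = 0}
      (Buckling.besselZero (k + 1) (n + 1))) ∧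
    Buckling.alpha k 1 κ ≤ Buckling.alpha (k + 2) 1 κ ∧
    (Buckling.alpha k 1 κ = Buckling.alpha (k + 2) 1 κ ↔
      ∃ n : ℕ, 1 ≤ n ∧
        κ = Buckling.besselZero (k + 1) n * Buckling.besselZero (k + 1) (n + 1)) ∧
    (∀ n : ℕ, 1 ≤ n →
      κ = Buckling.besselZero (k + 1) n * Buckling.besselZero (k + 1) (n + 1) →
        Buckling.alpha k 1 κ = Buckling.besselZero (k + 1) (n + 1) ∧
        Buckling.alpha (k + 1) 1 κ = Buckling.besselZero (k + 1) (n + 1) ∧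
        Buckling.alpha (k + 2) 1 κ = Buckling.besselZero (k + 1) (n + 1)) := by
  obtain ⟨θ, hθ⟩ := exists_isPhase_div k
  obtain ⟨θ₁, hθ₁⟩ := exists_isPhase_mul k
  obtain ⟨θ₂, hθ₂⟩ := exists_isPhase_neg_div (k + 1)
  have hs : 0 < Real.sqrt κ := Real.sqrt_pos.2 hκ
  have hz := exists_besselJ_succ_zero_gt k
  have root : ∀ a, Real.sqrt κ < a → θ a - θ (κ / a) = Real.pi →
      IsLeast {a : ℝ | Real.sqrt κ < a ∧ F k κ a = 0} a := fun a =>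
    hθ.isLeast_root hκ hκ.ne' fun x hx => F_eq k hκ hx
  have root₁ : ∀ a, Real.sqrt κ < a → θ₁ a - θ₁ (κ / a) = Real.pi →
      alpha (k + 1) 1 κ = a := fun a ha hac =>
    (hθ₁.isLeast_root hκ one_ne_zero (G := F (k + 1) κ)
      (fun x hx => by rw [F_succ_eq k hκ hx, one_mul]) ha hac).csInf_eq
  have root₂ : ∀ a, Real.sqrt κ < a → θ₂ a - θ₂ (κ / a) = Real.pi →
      alpha (k + 2) 1 κ = a := fun a ha hac =>
    (hθ₂.isLeast_root hκ hκ.ne' (G := F (k + 2) κ) (fun x hx => by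
      rw [F_succ_eq (k + 1) hκ hx]
      field_simp
      ring) ha hac).csInf_eq
  -- At a product of consecutive zeros, all three phases turn by `π` from one zero to the next.
  have consec : ∀ n : ℕ, 1 ≤ n → κ = besselZero (k + 1) n * besselZero (k + 1) (n + 1) →
      alpha k 1 κ = besselZero (k + 1) (n + 1) ∧ alpha (k + 1) 1 κ = besselZero (k + 1) (n + 1) ∧
      alpha (k + 2) 1 κ = besselZero (k + 1) (n + 1) := by
    intro n hn he
    have hp := besselZero_pos k hn
    have hJ := besselJ_besselZero k hn
    have hl := (besselZero_isLeast k n).2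
    have hp' : 0 < besselZero (k + 1) (n + 1) := hp.trans hl.1.1
    have hd : κ / besselZero (k + 1) (n + 1) = besselZero (k + 1) n := by
      rw [div_eq_iff hp'.ne', he]
    have hlt : Real.sqrt κ < besselZero (k + 1) (n + 1) := by
      rw [Real.sqrt_lt' hp', he, sq]
      exact mul_lt_mul_of_pos_right hl.1.1 hp'
    refine ⟨(root _ hlt ?_).csInf_eq, root₁ _ hlt ?_, root₂ _ hlt ?_⟩ <;> rw [hd]
    · exact hθ.sub_eq_pi_of_isLeast hp hJ hl
    · exact hθ₁.sub_eq_pi_of_isLeast hp hJ hl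
    · exact hθ₂.sub_eq_pi_of_isLeast hp hJ hl
  obtain ⟨a, ha, hac⟩ := hθ.exists_sub_eq_pi hz hκ
  obtain ⟨b, hb, hbc⟩ := hθ₂.exists_sub_eq_pi hz hκ
  have haα : alpha k 1 κ = a := (root a ha hac).csInf_eq
  have hbα : alpha (k + 2) 1 κ = b := root₂ b hb hbc
  have ha0 : 0 < a := hs.trans ha
  have hy0 : 0 < κ / a := div_pos hκ ha0
  have hya : κ / a < a := by
    rw [div_lt_iff₀ ha0]
    nlinarith [Real.mul_self_sqrt hκ.le]
  have hlt : besselJ (k + 1) a ≠ 0 → a < b := fun hne => by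
    have h1 : θ₂ a - θ₂ (κ / a) < Real.pi := by
      refine hθ.shear_sub_lt_pi hθ₂ (c := fun x => 2 * (k + 1) / x ^ 2)
        (fun x hx => by positivity) (fun x hx => ?_) hy0 hya ?_ hac hne
      · have := besselJ_recurrence k x
        field_simp
        linarith
      · exact div_lt_div_of_pos_left (by positivity) (by positivity)
          (pow_lt_pow_left₀ hya hy0.le two_ne_zero)
    by_contra! hba
    rcases hba.eq_or_lt with rfl | hba
    · exact h1.ne hbc
    · exact ((hθ₂.sub_lt_sub hκ (hs.trans hb) hba).trans h1).ne hbc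
  have hzero : besselJ (k + 1) a = 0 →
      ∃ n : ℕ, 1 ≤ n ∧ κ = besselZero (k + 1) n * besselZero (k + 1) (n + 1) := fun h0 => by
    have hy : besselJ (k + 1) (κ / a) = 0 := (hθ.zero_of_sub_eq_pi hy0 ha0 hac).2 h0
    obtain ⟨n, hn, hne⟩ := exists_besselZero_eq k hy0 hy
    have hl := hθ.isLeast_of_sub_eq_pi hy0 ha0 hy hac
    rw [← hne] at hl
    refine ⟨n, hn, ?_⟩
    rw [(besselZero_isLeast k n).2.unique hl, hne, div_mul_cancel₀ _ ha0.ne']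
  have heq : alpha k 1 κ = alpha (k + 2) 1 κ ↔
      ∃ n : ℕ, 1 ≤ n ∧ κ = besselZero (k + 1) n * besselZero (k + 1) (n + 1) := by
    constructor
    · intro h
      refine hzero (by_contra fun hne => (hlt hne).ne ?_)
      rw [← haα, ← hbα, h]
    · rintro ⟨n, hn, he⟩
      obtain ⟨h1, -, h2⟩ := consec n hn he
      rw [h1, h2]
  refine ⟨haα ▸ root a ha hac, fun n => (besselZero_isLeast k n).2, ?_, heq, consec⟩
  by_cases h0 : besselJ (k + 1) a = 0
  · exact (heq.2 (hzero h0)).le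
  · rw [haα, hbα]
    exact (hlt h0).le
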